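/- **Model.** $N$ processes sit at pairwise distinct points of the plane. Communication is synchronous and point to point; senders cannot be spoofed (oral messages); every process knows all positions. A faulty (Byzantine) process may send arbitrary messages. In *geoconsensus* every process has an input in $\{0,1\}$, and in every computation the correct processes must reach irrevocable decisions with *agreement* (no two correct processes decide differently), *validity* (if all correct processes have input $v$, every correct process decides $v$) and *termination* (every correct process decides). There are $M\ge 1$ fault areas $F$, which are closed discs of the same diameter $D$ placed at arbitrary locations unknown to the processes; any process lying in one of them may be Byzantine, all other processes are correct, and $f$ denotes the number of faulty processes. **Cover.** Let $\ell>0$. Divide the processes greedily, from bottom to top, into slabs: the first slab is $b\le y\le b+\ell$ with $b$ the least $y$-coordinate, and the next slab starts at the least $y$-coordinate not yet covered. Cover the processes of each slab in the same way, from left to right, by squares $[a,a+\ell]\times[b,b+\ell]$. The cover set $\mathcal A$ consists of the circles (closed discs) of diameter $\ell$ centered at the midpoints of the four sides of these squares, except those circles that contain no process. The *leader* of a circle is the process in it with the least $y$-coordinate and, among several of these, the least $x$-coordinate. **Algorithm GENERIC** (with overlap number $n(F)$; put $t=n(F)\,M$). The leaders run the oral-message algorithm PSL of Pease, Shostak and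 Lamport with fault bound $t$, i.e. with $t+1$ rounds of information exchange, where there is one participant for each circle $A\in\mathcal A$, its role being played by the leader of $A$ (a process that leads several circles plays all their roles). Each leader then decides on the majority value of the PSL vector ($0$ in case of a tie), and broadcasts this decision in one more round. A process that is not a leader adopts a decision that is announced by the leaders of at least $2t+1$ circles of $\mathcal A$. **Theorem.** GENERIC solves geoconsensus, with every correct process deciding within $n(F)M+2$ rounds, in each of the following cases, for every placement of the $M$ circular fault areas and every set of $f$ faulty processes covered by them. - $F$ has diameter $\ell$, $n(F)=28$, $|\mathcal A|\ge 85M$ and $f\le N-57M$. - $F$ has diameter $\sqrt2\,\ell$, $n(F)=32$, $|\mathcal A|\ge 97M$ and $f\le N-65M$. - $F$ has diameter $\ell/\sqrt2$, $n(F)=16$, $|\mathcal A|\ge 49M$ and $f\le N-33M$. -/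

import Mathlib

/-! ### Synchronous computations with Byzantine processes -/

/-- A deterministic synchronous message-passing algorithm for `N` processes with binary inputs and
decisions.  Rounds are numbered `0, 1, 2, …`; in a round every process may send a separate
message to each process (`none` means that no message is sent), then it updates its state from the
messages that it received in this round. -/
structure SyncAlgorithm (N : ℕ) where
  State : Type
  Msg : Type
  init : Fin N → Bool → State
  send : ℕ → Fin N → State → Fin N → Option Msg
  step : ℕ → Fin N → State → (Fin N → Option Msg) → State
  decision : State → Option Bool

namespace SyncAlgorithm

variable {N : ℕ}

/-- `state r p` is the state of `p` after `r` rounds and `msg r p q` is the message which `p` sends to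
`q` in round `r`.  Correct processes follow the algorithm.  The messages of faulty processes are
arbitrary, and may differ from receiver to receiver, but the sender of a message is never spoofed. -/
structure IsComputation (alg : SyncAlgorithm N) (faulty : Finset (Fin N)) (input : Fin N → Bool)
    (state : ℕ → Fin N → alg.State) (msg : ℕ → Fin N → Fin N → Option alg.Msg) : Prop where
  start : ∀ p, p ∉ faulty → state 0 p = alg.init p (input p)
  sends : ∀ r p, p ∉ faulty → ∀ q, msg r p q = alg.send r p (state r p) q
  steps : ∀ r p, p ∉ faulty → state (r + 1) p = alg.step r p (state r p) (fun q => msg r q p)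

/-- In every computation in which the processes outside `faulty` are correct, the decisions of the
correct processes are irrevocable and satisfy agreement, validity and termination, the latter
within `R` rounds. -/
def SolvesConsensus (alg : SyncAlgorithm N) (faulty : Finset (Fin N)) (R : ℕ) : Prop :=
  ∀ (input : Fin N → Bool) (state : ℕ → Fin N → alg.State)
    (msg : ℕ → Fin N → Fin N → Option alg.Msg),
    alg.IsComputation faulty input state msg →
      -- irrevocability
      (∀ p, p ∉ faulty → ∀ r r' v, r ≤ r' →
        alg.decision (state r p) = some v → alg.decision (state r' p) = some v) ∧
      -- agreement
      (∀ p, p ∉ faulty → ∀ q, q ∉ faulty → ∀ r r' v v',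
        alg.decision (state r p) = some v → alg.decision (state r' q) = some v' → v = v') ∧
      -- validity
      (∀ v, (∀ p, p ∉ faulty → input p = v) →
        ∀ p, p ∉ faulty → ∃ r, alg.decision (state r p) = some v) ∧
      -- termination
      (∀ p, p ∉ faulty → ∃ r v, r ≤ R ∧ alg.decision (state r p) = some v)

end SyncAlgorithm

/-! ### Processes in the plane, circular fault areas, and the greedy circle cover -/

abbrev Plane := EuclideanSpace ℝ (Fin 2)

/-- The faulty processes all lie in the union of `M` closed discs of diameter `D`, placed anywhere. -/
def IsFaultPattern {N : ℕ} (pos : Fin N → Plane) (M : ℕ) (D : ℝ) (faulty : Finset (Fin N)) : Prop :=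
  ∃ center : Fin M → Plane, ∀ p ∈ faulty, ∃ i, pos p ∈ Metric.closedBall (center i) (D / 2)

/-- The left ends of the intervals of length `ℓ` which cover the finite set `s` greedily: the first
interval starts at the least element of `s`, the next one starts at the least element of `s` that is not
yet covered, and so on.  (Erasing the least element matters only for `ℓ < 0`.) -/
noncomputable def greedyStarts (ℓ : ℝ) (s : Finset ℝ) : Finset ℝ :=
  if h : s.Nonempty then
    insert (s.min' h) (greedyStarts ℓ ((s.erase (s.min' h)).filter (fun x => s.min' h + ℓ < x)))
  else ∅
termination_by s.card
decreasing_by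
  exact lt_of_le_of_lt (Finset.card_filter_le _ _) (Finset.card_erase_lt_of_mem (s.min'_mem h))

/-- The lower left corners `(a, b)` of the greedy cover by axis-aligned squares
`[a, a + ℓ] × [b, b + ℓ]`: the points are divided greedily into slabs `b ≤ y ≤ b + ℓ`, and the points of
each slab are covered greedily from left to right. -/
noncomputable def squareCover {N : ℕ} (pos : Fin N → Plane) (ℓ : ℝ) : Finset (ℝ × ℝ) :=
  (greedyStarts ℓ (Finset.univ.image (fun p => pos p 1))).biUnion fun b =>
    (greedyStarts ℓ ((Finset.univ.filter (fun p => b ≤ pos p 1 ∧ pos p 1 ≤ b + ℓ)).image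
      (fun p => pos p 0))).image fun a => (a, b)

open Classical in
/-- The processes covered by the closed disc of diameter `ℓ` with center `c`. -/
noncomputable def coveredBy {N : ℕ} (pos : Fin N → Plane) (ℓ : ℝ) (c : Plane) : Finset (Fin N) :=
  Finset.univ.filter (fun p => pos p ∈ Metric.closedBall c (ℓ / 2))

open Classical in
/-- The greedy circle cover, a circle of diameter `ℓ` being represented by its center: the circles
centered at the midpoints of the four sides of the squares of the greedy square cover, without those
circles that cover no process (they have no leader). -/
noncomputable def circleCover {N : ℕ} (pos : Fin N → Plane) (ℓ : ℝ) : Finset Plane :=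
  ((squareCover pos ℓ).biUnion fun ab =>
    {!₂[ab.1 + ℓ / 2, ab.2], !₂[ab.1 + ℓ / 2, ab.2 + ℓ],
      !₂[ab.1, ab.2 + ℓ / 2], !₂[ab.1 + ℓ, ab.2 + ℓ / 2]}).filter
    fun c => (coveredBy pos ℓ c).Nonempty

/-- The circles of the cover. -/
abbrev Cover {N : ℕ} (pos : Fin N → Plane) (ℓ : ℝ) : Type := {c : Plane // c ∈ circleCover pos ℓ}

theorem Cover.nonempty {N : ℕ} {pos : Fin N → Plane} {ℓ : ℝ} (c : Cover pos ℓ) :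
    (coveredBy pos ℓ c.1).Nonempty := by
  have h := c.2
  unfold circleCover at h
  exact (Finset.mem_filter.mp h).2

/-- The leader of a circle: among the processes that it covers, the one with the least `y`-coordinate,
and among several of these the one with the least `x`-coordinate. -/
noncomputable def leader {N : ℕ} {pos : Fin N → Plane} {ℓ : ℝ} (c : Cover pos ℓ) : Fin N :=
  Classical.choose (Finset.exists_min_image (coveredBy pos ℓ c.1)
    (fun p => toLex (pos p 1, pos p 0)) c.nonempty)

/-! ### The consensus algorithm of Pease, Shostak and Lamport for oral messages -/

open Classical in
/-- The vector that a participant computes after `m + 1` rounds of information exchange among the set `P`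
of participants, at most `m` of which are faulty.  Here `σ [q₁, …, qₖ]` is the value which this participant
got from `q₁`, who claims to have got it from `q₂`, and so on up to `qₖ`, who claims it to be his input
value.  The entry for `q` is the value recorded for `q`; `none` is the value NIL. -/
noncomputable def pslVector {ι : Type} :
    ℕ → Finset ι → (List ι → Bool) → ι → Option Bool
  | 0, _, σ, q => some (σ [q])
  | m + 1, P, σ, q =>
    if ∃ Q ⊆ P, P.card + (m + 1) < 2 * Q.card ∧
        ∀ w : List ι, w.length ≤ m + 1 → (∀ x ∈ w, x ∈ Q) → σ (w ++ [q]) = σ [q] then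
      some (σ [q])
    else
      let vec := pslVector m (P.erase q) (fun w => σ (w ++ [q]))
      if (P.card + (m + 1)) / 2 ≤ ((P.erase q).filter (fun r => vec r = some true)).card then
        some true
      else if (P.card + (m + 1)) / 2 ≤ ((P.erase q).filter (fun r => vec r = some false)).card then
        some false
      else none

/-- The decision: the majority value of the vector (`false` if there is a tie). -/
noncomputable def pslDecision {ι : Type} [Fintype ι] (m : ℕ) (σ : List ι → Bool) : Bool :=
  decide ((Finset.univ.filter (fun q => pslVector m Finset.univ σ q = some false)).card <
    (Finset.univ.filter (fun q => pslVector m Finset.univ σ q = some true)).card)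

/-! ### The algorithm GENERIC -/

/-- A message is either a relay message of the information exchange or the announcement of a decision. -/
inductive GenericMsg (ι : Type) : Type
  | relay (values : List ι → Bool)
  | announce (v : Bool)

/-- `view []` is the input of the process, and `view (c :: w)` is what the leader of circle `c` reported
to it about `w`. -/
structure GenericState (ι : Type) : Type where
  view : List ι → Bool
  decided : Option Bool

/-- The value for `w` in a received message; the default is `false` if there is no proper message. -/
def GenericMsg.value {ι : Type} (m : Option (GenericMsg ι)) (w : List ι) : Bool :=
  match m with
  | some (GenericMsg.relay values) => values w
  | _ => false

open Classical in
/-- The number of circles whose leader announces the decision `v`. -/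
noncomputable def announcements {N : ℕ} (pos : Fin N → Plane) (ℓ : ℝ)
    (inbox : Fin N → Option (GenericMsg (Cover pos ℓ))) (v : Bool) : ℕ :=
  (Finset.univ.filter
    (fun c : Cover pos ℓ => inbox (leader c) = some (GenericMsg.announce v))).card

open Classical in
/-- GENERIC for the circle cover of diameter `ℓ`, where `t` is the number of circles with a faulty leader
that has to be tolerated.  In rounds `0, …, t` the leaders run the consensus algorithm of Pease,
Shostak and Lamport, with one participant for each circle of the cover, and decide; in round `t + 1` they
announce their decision to all processes, and the other processes adopt a decision that is
announced for at least `2 t + 1` circles. -/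
noncomputable def generic {N : ℕ} (pos : Fin N → Plane) (ℓ : ℝ) (t : ℕ) : SyncAlgorithm N where
  State := GenericState (Cover pos ℓ)
  Msg := GenericMsg (Cover pos ℓ)
  init := fun _ b => { view := fun w => if w = [] then b else false, decided := none }
  send := fun r p s q =>
    if ∃ c : Cover pos ℓ, leader c = p then
      if r ≤ t then
        if ∃ c : Cover pos ℓ, leader c = q then
          some (GenericMsg.relay (fun w => if w.length = r then s.view w else false))
        else none
      else if r = t + 1 then s.decided.map GenericMsg.announce
      else none
    else none
  step := fun r p s inbox =>
    if ∃ c : Cover pos ℓ, leader c = p then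
      if r ≤ t then
        let view' : List (Cover pos ℓ) → Bool := fun w =>
          match w with
          | [] => s.view []
          | c :: w' =>
            if w'.length = r then GenericMsg.value (inbox (leader c)) w' else s.view (c :: w')
        { view := view'
          decided := if r = t then some (pslDecision t view') else s.decided }
      else s
    else if r = t + 1 then
      { view := s.view
        decided :=
          if 2 * t + 1 ≤ announcements pos ℓ inbox true then some true
          else if 2 * t + 1 ≤ announcements pos ℓ inbox false then some false
          else none }
    else s
  decision := fun s => s.decided

/-! The proof has two independent halves, joined in `generic_solvesConsensus`. Consensus: with more
than `3 t` participants, at most `t` of them bad, every correct participant computes the same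
vector, and it records correct inputs truthfully. Agreement (`pslVector_agreement`) is by induction
on the number of rounds: deleting a bad `q` lowers the number of bad participants, and two large
unanimous sets share a correct member. Correct leaders thus announce one value, which the other
processes adopt since bad circles are too few to outvote it. Geometry: a circle with a faulty leader
has its center within `(ℓ + D) / 2` of the center of a fault disc of diameter `D`. Centers are
corners of the greedy squares shifted by one of four offsets. Rows, and corners within a row, are
more than `ℓ` apart, so a disc contains at most 4 corners, or 8 for the largest fault areas; this
bounds the bad circles by 16 or 32 per fault area. -/

/-! ### Correctness of the algorithm of Pease, Shostak and Lamport -/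

section PSL

variable {ι : Type}

/-- Reports travel unchanged along chains of participants outside `bad`, for reports of length at
most `k + 1`. -/
def FaithfulReports (bad : Finset ι) (k : ℕ) (σ : ι → List ι → Bool) : Prop :=
  ∀ p, p ∉ bad → ∀ q, q ∉ bad → ∀ w : List ι, w.length ≤ k → σ p (q :: w) = σ q w

/-- This is the subinstance for `q`: each participant's input becomes what `q` told it, so `q`
itself may be bad. One level of relaying is used up. -/
theorem FaithfulReports.append {bad : Finset ι} {k : ℕ} {σ : ι → List ι → Bool}
    (h : FaithfulReports bad (k + 1) σ) (q : ι) :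
    FaithfulReports bad k (fun p w => σ p (w ++ [q])) := by
  intro p hp r hr w hw
  exact h p hp r hr (w ++ [q]) (by simpa using hw)

theorem FaithfulReports.chain {bad : Finset ι} {k : ℕ} {σ : ι → List ι → Bool}
    (h : FaithfulReports bad k σ) {q : ι} (hq : q ∉ bad) :
    ∀ (w : List ι) (p : ι), p ∉ bad → w.length ≤ k → (∀ x ∈ w, x ∉ bad) →
      σ p (w ++ [q]) = σ q []
  | [], p, hp, _, _ => h p hp q hq [] (by simp)
  | d :: w, p, hp, hw, hx => by
    have hd : d ∉ bad := hx d (by simp)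
    have hw' : w.length + 1 ≤ k := by simpa using hw
    rw [List.cons_append, h p hp d hd (w ++ [q]) (by simpa using hw')]
    exact h.chain hq w d hd (by omega) (fun x hxw => hx x (by simp [hxw]))

/-- This makes the correct participants a witness for the early exit in `pslVector`. -/
theorem card_lt_of_card_sdiff [DecidableEq ι] {P bad : Finset ι} {m : ℕ}
    (hP : 3 * m < P.card) (hbad : (P ∩ bad).card ≤ m) : P.card + m < 2 * (P \ bad).card := by
  have := Finset.card_sdiff_add_card_inter P bad
  omega

/-- The entry of a correct participant is its input, whoever correct computes it. -/
theorem pslVector_of_notMem [DecidableEq ι] {bad P : Finset ι} {m : ℕ} {σ : ι → List ι → Bool}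
    (h : FaithfulReports bad m σ) (hP : 3 * m < P.card) (hbad : (P ∩ bad).card ≤ m)
    {p q : ι} (hp : p ∉ bad) (hq : q ∉ bad) : pslVector m P (σ p) q = some (σ q []) := by
  have hpq : σ p [q] = σ q [] := h p hp q hq [] (by simp)
  cases m with
  | zero => simp [pslVector, hpq]
  | succ m =>
    rw [pslVector, if_pos, hpq]
    refine ⟨P \ bad, Finset.sdiff_subset, card_lt_of_card_sdiff hP hbad, fun w hw hx => ?_⟩
    rw [hpq]
    exact h.chain hq w p hp hw (fun x hxw => (Finset.mem_sdiff.mp (hx x hxw)).2)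

/-- The entry of a participant whose reports are unanimous within a large set. -/
theorem pslVector_of_unanimous {P Q : Finset ι} {m : ℕ} {τ : List ι → Bool} {q : ι}
    (hQ : Q ⊆ P) (hcard : P.card + m < 2 * Q.card)
    (hτ : ∀ w : List ι, w.length ≤ m → (∀ x ∈ w, x ∈ Q) → τ (w ++ [q]) = τ [q]) :
    pslVector m P τ q = some (τ [q]) := by
  cases m with
  | zero => rfl
  | succ m => rw [pslVector, if_pos ⟨Q, hQ, hcard, hτ⟩]

open Classical in
/-- A value that is recorded for sufficiently many participants wins the vote. -/
theorem vote_eq {P : Finset ι} {n m : ℕ} {vec : ι → Option Bool} {v : Bool} (hP : P.card < n)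
    (hv : n + m ≤ 2 * (P.filter (fun r => vec r = some v)).card + 1)
    (hm : 1 ≤ m) :
    (if (n + m) / 2 ≤ (P.filter (fun r => vec r = some true)).card then some true
      else if (n + m) / 2 ≤ (P.filter (fun r => vec r = some false)).card then some false
      else none) = some v := by
  have hdisj : (P.filter (fun r => vec r = some true)).card +
      (P.filter (fun r => vec r = some false)).card ≤ P.card := by
    rw [← Finset.card_union_of_disjoint]
    · exact Finset.card_le_card (Finset.union_subset (Finset.filter_subset _ _)
        (Finset.filter_subset _ _))
    · rw [Finset.disjoint_filter]
      intro x _ h1 h2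
      simp [h1] at h2
  cases v with
  | true => rw [if_pos (by omega)]
  | false => rw [if_neg (by omega), if_pos (by omega)]

/-- If one correct participant exits early with the value `v`, then another one records `v`. -/
theorem pslVector_succ_of_unanimous [DecidableEq ι] {P Q : Finset ι} {m : ℕ} {τ τ' : List ι → Bool}
    {q : ι} (hq : q ∈ P) (hQ : Q ⊆ P) (hcard : P.card + (m + 1) < 2 * Q.card)
    (hτ : ∀ w : List ι, w.length ≤ m + 1 → (∀ x ∈ w, x ∈ Q) → τ (w ++ [q]) = τ [q])
    (hrec : ∀ r ∈ P.erase q, pslVector m (P.erase q) (fun w => τ (w ++ [q])) r =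
      pslVector m (P.erase q) (fun w => τ' (w ++ [q])) r)
    (hexit : ¬ ∃ Q ⊆ P, P.card + (m + 1) < 2 * Q.card ∧
        ∀ w : List ι, w.length ≤ m + 1 → (∀ x ∈ w, x ∈ Q) → τ' (w ++ [q]) = τ' [q]) :
    pslVector (m + 1) P τ' q = some (τ [q]) := by
  have hPc := Finset.card_erase_add_one hq
  have hQc := Finset.pred_card_le_card_erase (s := Q) (a := q)
  have hval : ∀ r ∈ Q.erase q,
      pslVector m (P.erase q) (fun w => τ' (w ++ [q])) r = some (τ [q]) := by
    -- Since `r` is in `Q`, its report about `q` agrees with `τ [q]` and is itself unanimous within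
    -- `Q.erase q`, so the subinstance exits early at `r` too.
    intro r hr
    have hrQ := Finset.mem_of_mem_erase hr
    rw [← hrec r (Finset.erase_subset_erase q hQ hr)]
    have hr1 : τ ([r] ++ [q]) = τ [q] := hτ [r] (by simp) (by simpa using hrQ)
    rw [pslVector_of_unanimous (Q := Q.erase q) (Finset.erase_subset_erase q hQ) (by omega), hr1]
    intro w hw hx
    rw [hr1]
    refine hτ (w ++ [r]) (by simpa using hw) fun x hxw => ?_
    rcases List.mem_append.mp hxw with hxw | hxw
    · exact Finset.mem_of_mem_erase (hx x hxw)
    · rw [List.mem_singleton.mp hxw]; exact hrQ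
  rw [pslVector, if_neg hexit]
  -- `pslVector` erases with classical decidable equality; this identifies it with the ambient
  -- instance.
  have hinst : (fun a b => Classical.propDecidable (a = b) : DecidableEq ι) = ‹DecidableEq ι› :=
    Subsingleton.elim _ _
  rw [hinst]
  refine vote_eq (n := P.card) (by omega) ?_ (by omega)
  have hsub : Q.erase q ⊆ (P.erase q).filter
      (fun r => pslVector m (P.erase q) (fun w => τ' (w ++ [q])) r = some (τ [q])) := fun r hr =>
    Finset.mem_filter.mpr ⟨Finset.erase_subset_erase q hQ hr, hval r hr⟩
  have := Finset.card_le_card hsub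
  omega

/-- Correct participants compute the same vector. -/
theorem pslVector_agreement [DecidableEq ι] {bad : Finset ι} :
    ∀ (m : ℕ) (P : Finset ι) (σ : ι → List ι → Bool), FaithfulReports bad m σ →
      3 * m < P.card → (P ∩ bad).card ≤ m → ∀ p, p ∉ bad → ∀ p', p' ∉ bad → ∀ q ∈ P,
        pslVector m P (σ p) q = pslVector m P (σ p') q := by
  intro m
  induction m with
  | zero =>
    intro P σ h hP hbad p hp p' hp' q hq
    have hq' : q ∉ bad := fun hqb => by
      have : q ∈ P ∩ bad := Finset.mem_inter.mpr ⟨hq, hqb⟩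
      rw [Finset.card_eq_zero.mp (Nat.le_zero.mp hbad)] at this
      simp at this
    rw [pslVector_of_notMem h hP hbad hp hq', pslVector_of_notMem h hP hbad hp' hq']
  | succ m ih =>
    intro P σ h hP hbad p hp p' hp' q hq
    by_cases hqb : q ∈ bad
    swap
    · rw [pslVector_of_notMem h hP hbad hp hqb, pslVector_of_notMem h hP hbad hp' hqb]
    have hPc := Finset.card_erase_add_one hq
    -- Removing the bad `q` pays for the decrease of `m`, so the induction hypothesis applies to the
    -- rest.
    have hbad' : (P.erase q ∩ bad).card ≤ m := by
      rw [Finset.erase_inter]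
      have := Finset.card_erase_add_one (Finset.mem_inter.mpr ⟨hq, hqb⟩)
      omega
    have hrec : ∀ p, p ∉ bad → ∀ p', p' ∉ bad → ∀ r ∈ P.erase q,
        pslVector m (P.erase q) (fun w => σ p (w ++ [q])) r =
        pslVector m (P.erase q) (fun w => σ p' (w ++ [q])) r :=
      ih (P.erase q) (fun p w => σ p (w ++ [q])) (h.append q) (by omega) hbad'
    by_cases he : ∃ Q ⊆ P, P.card + (m + 1) < 2 * Q.card ∧
        ∀ w : List ι, w.length ≤ m + 1 → (∀ x ∈ w, x ∈ Q) → σ p (w ++ [q]) = σ p [q]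
    · obtain ⟨Q, hQ, hcard, hτ⟩ := he
      rw [pslVector_of_unanimous hQ hcard hτ]
      by_cases he' : ∃ Q ⊆ P, P.card + (m + 1) < 2 * Q.card ∧
          ∀ w : List ι, w.length ≤ m + 1 → (∀ x ∈ w, x ∈ Q) → σ p' (w ++ [q]) = σ p' [q]
      · obtain ⟨Q', hQ', hcard', hτ'⟩ := he'
        rw [pslVector_of_unanimous hQ' hcard' hτ']
        -- The two sets overlap in more than `m + 1` elements, hence in a correct `d`, whose single
        -- report about `q` reaches both `p` and `p'`.
        obtain ⟨d, hd, hdb⟩ : ∃ d ∈ Q ∩ Q', d ∉ bad := by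
          by_contra! hcon
          have h1 : Q ∩ Q' ⊆ P ∩ bad := fun d hd =>
            Finset.mem_inter.mpr ⟨hQ (Finset.mem_inter.mp hd).1, hcon d hd⟩
          have h2 := Finset.card_le_card h1
          have h3 := Finset.card_union_add_card_inter Q Q'
          have h4 := Finset.card_le_card (Finset.union_subset hQ hQ')
          omega
        rw [← hτ [d] (by simp) (by simpa using (Finset.mem_inter.mp hd).1),
          ← hτ' [d] (by simp) (by simpa using (Finset.mem_inter.mp hd).2)]
        exact congrArg some ((h p hp d hdb [q] (by simp)).trans (h p' hp' d hdb [q] (by simp)).symm)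
      · rw [pslVector_succ_of_unanimous hq hQ hcard hτ (hrec p hp p' hp') he']
    · by_cases he' : ∃ Q ⊆ P, P.card + (m + 1) < 2 * Q.card ∧
          ∀ w : List ι, w.length ≤ m + 1 → (∀ x ∈ w, x ∈ Q) → σ p' (w ++ [q]) = σ p' [q]
      · obtain ⟨Q', hQ', hcard', hτ'⟩ := he'
        rw [pslVector_of_unanimous hQ' hcard' hτ',
          pslVector_succ_of_unanimous hq hQ' hcard' hτ' (hrec p' hp' p hp) he]
      -- Neither exits early, so both take the same vote over equal vectors.
      · have hinst : (fun a b => Classical.propDecidable (a = b) : DecidableEq ι) =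
            ‹DecidableEq ι› := Subsingleton.elim _ _
        have hfilter : ∀ v : Bool, (P.erase q).filter (fun r =>
              pslVector m (P.erase q) (fun w => σ p (w ++ [q])) r = some v) =
            (P.erase q).filter (fun r =>
              pslVector m (P.erase q) (fun w => σ p' (w ++ [q])) r = some v) := fun v =>
          Finset.filter_congr fun r hr => by rw [hrec p hp p' hp' r hr]
        rw [pslVector, pslVector, if_neg he, if_neg he', hinst]
        simp only [hfilter]

/-! ### From the vector to the decision -/

theorem pslDecision_agreement [Fintype ι] [DecidableEq ι] {bad : Finset ι} {m : ℕ}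
    {σ : ι → List ι → Bool} (h : FaithfulReports bad m σ) (hcard : 3 * m < Fintype.card ι)
    (hbad : bad.card ≤ m) {p p' : ι} (hp : p ∉ bad) (hp' : p' ∉ bad) :
    pslDecision m (σ p) = pslDecision m (σ p') := by
  have hv : ∀ q, pslVector m Finset.univ (σ p) q = pslVector m Finset.univ (σ p') q := fun q =>
    pslVector_agreement m Finset.univ σ h hcard (by simpa using hbad) p hp p' hp' q
      (Finset.mem_univ q)
  simp only [pslDecision, hv]

/-- Correct entries all equal `v` and strictly outnumber the bad ones, so no tie arises. -/
theorem pslDecision_validity [Fintype ι] [DecidableEq ι] {bad : Finset ι} {m : ℕ}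
    {σ : ι → List ι → Bool} (h : FaithfulReports bad m σ) (hcard : 3 * m < Fintype.card ι)
    (hbad : bad.card ≤ m) {v : Bool} (hv : ∀ q, q ∉ bad → σ q [] = v) {p : ι} (hp : p ∉ bad) :
    pslDecision m (σ p) = v := by
  have hvec : ∀ q, q ∉ bad → pslVector m Finset.univ (σ p) q = some v := fun q hq => by
    rw [pslVector_of_notMem h hcard (by simpa using hbad) hp hq, hv q hq]
  have hyes : badᶜ ⊆ Finset.univ.filter
      (fun q => pslVector m Finset.univ (σ p) q = some v) := fun q hq => by
    simpa using hvec q (Finset.mem_compl.mp hq)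
  have hno : Finset.univ.filter
      (fun q => pslVector m Finset.univ (σ p) q = some (!v)) ⊆ bad := fun q hq => by
    by_contra hqb
    have := hvec q hqb
    rw [(Finset.mem_filter.mp hq).2] at this
    simp at this
  have h1 := Finset.card_le_card hyes
  have h2 := Finset.card_le_card hno
  have h3 := Finset.card_compl bad
  cases v <;> simp only [pslDecision, decide_eq_true_eq, decide_eq_false_iff_not,
    Bool.not_true, Bool.not_false] at * <;> omega

end PSL

/-! ### The number of circles of the cover that meet a disc -/

/-- Distinct elements are more than `ℓ` apart. -/
def IsSpread (ℓ : ℝ) (s : Finset ℝ) : Prop := ∀ x ∈ s, ∀ y ∈ s, x < y → x + ℓ < y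

theorem IsSpread.subset {ℓ : ℝ} {s t : Finset ℝ} (h : IsSpread ℓ t) (hst : s ⊆ t) :
    IsSpread ℓ s := fun x hx y hy => h x (hst hx) y (hst hy)

theorem greedyStarts_subset (ℓ : ℝ) (s : Finset ℝ) : greedyStarts ℓ s ⊆ s := by
  induction s using Finset.strongInduction with
  | H s ih =>
    rw [greedyStarts]
    split_ifs with h
    · have hsub : (s.erase (s.min' h)).filter (fun x => s.min' h + ℓ < x) ⊆ s.erase (s.min' h) :=
        Finset.filter_subset _ _
      have hlt := lt_of_le_of_lt hsub (Finset.erase_ssubset (s.min'_mem h))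
      exact Finset.insert_subset (s.min'_mem h) ((ih _ hlt).trans hlt.subset)
    · exact Finset.empty_subset _

theorem isSpread_greedyStarts (ℓ : ℝ) (s : Finset ℝ) : IsSpread ℓ (greedyStarts ℓ s) := by
  induction s using Finset.strongInduction with
  | H s ih =>
    rw [greedyStarts]
    split_ifs with h
    · have hsub : (s.erase (s.min' h)).filter (fun x => s.min' h + ℓ < x) ⊆ s.erase (s.min' h) :=
        Finset.filter_subset _ _
      have hlt := lt_of_le_of_lt hsub (Finset.erase_ssubset (s.min'_mem h))
      intro x hx y hy hxy
      rcases Finset.mem_insert.mp hy with rfl | hy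
      · have hxs : x ∈ s := by
          rcases Finset.mem_insert.mp hx with rfl | hx
          · exact s.min'_mem h
          · exact hlt.subset (greedyStarts_subset _ _ hx)
        exact absurd (s.min'_le x hxs) (not_le.mpr hxy)
      · rcases Finset.mem_insert.mp hx with rfl | hx
        · exact (Finset.mem_filter.mp (greedyStarts_subset _ _ hy)).2
        · exact ih _ hlt x hx y hy hxy
    · intro x hx
      simp at hx

/-- Gaps are strictly larger than `ℓ`, so `k + 2` points would span more than `(k + 1) * ℓ`; this is
why a closed interval of exactly that length is allowed. -/
theorem IsSpread.card_le {ℓ : ℝ} (k : ℕ) :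
    ∀ {s : Finset ℝ} {u v : ℝ}, IsSpread ℓ s → (∀ x ∈ s, u ≤ x ∧ x ≤ v) →
      v ≤ u + (k + 1) * ℓ → s.card ≤ k + 1 := by
  induction k with
  | zero =>
    intro s u v hs hx huv
    rw [zero_add, Finset.card_le_one]
    intro x hxs y hys
    have h1 := hx x hxs
    have h2 := hx y hys
    rcases lt_trichotomy x y with h | h | h
    · have := hs x hxs y hys h
      norm_num at huv
      linarith
    · exact h
    · have := hs y hys x hxs h
      norm_num at huv
      linarith
  | succ k ih =>
    intro s u v hs hx huv
    rcases s.eq_empty_or_nonempty with rfl | hne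
    · simp
    have hmin := s.min'_mem hne
    have hc := Finset.card_erase_add_one hmin
    have := ih (s := s.erase (s.min' hne)) (u := u + ℓ) (v := v)
      (hs.subset (Finset.erase_subset _ _)) (fun x hxs => by
        have hxs' := Finset.mem_of_mem_erase hxs
        have h1 := hs _ hmin x hxs' (lt_of_le_of_ne (s.min'_le x hxs')
          (Finset.ne_of_mem_erase hxs).symm)
        have h2 := (hx _ hmin).1
        exact ⟨by linarith, (hx x hxs').2⟩) (by push_cast at huv; linarith)
    omega

/-- The number of elements of a spread set within distance `ρ` of a point. -/
theorem IsSpread.card_filter_le {ℓ ρ x₀ : ℝ} {s : Finset ℝ} (hs : IsSpread ℓ s) (k : ℕ)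
    {p : ℝ → Prop} [DecidablePred p] (hp : ∀ x ∈ s, p x → |x - x₀| ≤ ρ)
    (hρ : 2 * ρ ≤ (k + 1) * ℓ) : (s.filter p).card ≤ k + 1 := by
  refine IsSpread.card_le k (u := x₀ - ρ) (v := x₀ + ρ) (hs.subset (Finset.filter_subset _ _))
    (fun x hx => ?_) (by linarith)
  obtain ⟨h1, h2⟩ := Finset.mem_filter.mp hx
  have := abs_le.mp (hp x h1 h2)
  exact ⟨by linarith, by linarith⟩

/-- Points arranged in spread rows: at most `k₁` rows meet a disc, at most `k₂` of them contain more than `c`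
points of the disc, and these contain at most `c + 1`. -/
theorem card_rows_le {B : Finset ℝ} {A : ℝ → Finset ℝ} {p : ℝ × ℝ → Prop} [DecidablePred p]
    {q₁ q₂ : ℝ → Prop} [DecidablePred q₁] [DecidablePred q₂] {k₁ k₂ c : ℕ}
    (h0 : ∀ b ∈ B, ¬ q₁ b → ((A b).filter fun a => p (a, b)).card = 0)
    (hc : ∀ b ∈ B, ¬ q₂ b → ((A b).filter fun a => p (a, b)).card ≤ c)
    (hc' : ∀ b ∈ B, ((A b).filter fun a => p (a, b)).card ≤ c + 1)
    (h1 : (B.filter q₁).card ≤ k₁) (h2 : (B.filter q₂).card ≤ k₂) :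
    ((B.biUnion fun b => (A b).image fun a => (a, b)).filter p).card ≤ k₁ * c + k₂ := by
  rw [Finset.filter_biUnion]
  refine Finset.card_biUnion_le.trans ?_
  -- A row is charged `c` for meeting the disc and one more for being exceptional.
  have hrow : ∀ b ∈ B, (((A b).image fun a => (a, b)).filter p).card ≤
      (if q₁ b then c else 0) + (if q₂ b then 1 else 0) := by
    intro b hb
    rw [Finset.filter_image]
    refine Finset.card_image_le.trans ?_
    have e0 := h0 b hb
    have e1 := hc b hb
    have e2 := hc' b hb
    split_ifs with g1 g2 g2
    · omega
    · have := e1 g2; omega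
    · have := e0 g1; omega
    · have := e0 g1; omega
  refine (Finset.sum_le_sum hrow).trans ?_
  rw [Finset.sum_add_distrib, ← Finset.sum_filter, ← Finset.sum_filter, Finset.sum_const,
    Finset.sum_const, smul_eq_mul, smul_eq_mul, mul_one]
  exact Nat.add_le_add (Nat.mul_le_mul_right c h1) h2

/-- The bounding square of side at most `2 * ℓ` suffices: it meets two rows, with two corners in
each. -/
theorem card_squareCover_filter_le_four {N : ℕ} (pos : Fin N → Plane) {ℓ R : ℝ} (hR0 : 0 ≤ R)
    (hR : R ≤ ℓ) (x₀ y₀ : ℝ) :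
    ((squareCover pos ℓ).filter fun ab => (ab.1 - x₀) ^ 2 + (ab.2 - y₀) ^ 2 ≤ R ^ 2).card ≤ 4 := by
  classical
  have hx : ∀ a b : ℝ, (a - x₀) ^ 2 + (b - y₀) ^ 2 ≤ R ^ 2 → |a - x₀| ≤ R := fun a b h =>
    abs_le_of_sq_le_sq (by nlinarith [sq_nonneg (b - y₀)]) hR0
  have hy : ∀ a b : ℝ, (a - x₀) ^ 2 + (b - y₀) ^ 2 ≤ R ^ 2 → |b - y₀| ≤ R := fun a b h =>
    abs_le_of_sq_le_sq (by nlinarith [sq_nonneg (a - x₀)]) hR0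
  refine (card_rows_le (k₁ := 2) (k₂ := 0) (c := 2) (q₁ := fun b => |b - y₀| ≤ R)
    (q₂ := fun _ => False) (fun b _ hb => ?_) (fun b _ _ => ?_) (fun b _ => ?_) ?_ (by simp))
  · rw [Finset.card_eq_zero, Finset.filter_eq_empty_iff]
    exact fun a _ h => hb (hy a b h)
  · exact (isSpread_greedyStarts ℓ _).card_filter_le 1 (fun a _ h => hx a b h)
      (by norm_num; linarith)
  · exact ((isSpread_greedyStarts ℓ _).card_filter_le 1 (fun a _ h => hx a b h)
      (by norm_num; linarith)).trans (by norm_num)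
  · exact (isSpread_greedyStarts ℓ _).card_filter_le 1 (fun b _ h => h) (by norm_num; linarith)

/-- The bounding square alone gives only `3 * 3`. A row farther than `ℓ` from the center cuts a
short chord with at most two corners, and at most two rows are nearer, whence `3 * 2 + 2`. -/
theorem card_squareCover_filter_le_eight {N : ℕ} (pos : Fin N → Plane) {ℓ R : ℝ} (hℓ : 0 < ℓ)
    (hR0 : 0 ≤ R) (hR : R ≤ 61 / 50 * ℓ) (x₀ y₀ : ℝ) :
    ((squareCover pos ℓ).filter fun ab => (ab.1 - x₀) ^ 2 + (ab.2 - y₀) ^ 2 ≤ R ^ 2).card ≤ 8 := by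
  classical
  have hx : ∀ a b : ℝ, (a - x₀) ^ 2 + (b - y₀) ^ 2 ≤ R ^ 2 → |a - x₀| ≤ R := fun a b h =>
    abs_le_of_sq_le_sq (by nlinarith [sq_nonneg (b - y₀)]) hR0
  have hy : ∀ a b : ℝ, (a - x₀) ^ 2 + (b - y₀) ^ 2 ≤ R ^ 2 → |b - y₀| ≤ R := fun a b h =>
    abs_le_of_sq_le_sq (by nlinarith [sq_nonneg (a - x₀)]) hR0
  refine (card_rows_le (k₁ := 3) (k₂ := 2) (c := 2) (q₁ := fun b => |b - y₀| ≤ R)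
    (q₂ := fun b => |b - y₀| ≤ ℓ) (fun b _ hb => ?_) (fun b _ hb => ?_) (fun b _ => ?_) ?_ ?_)
  · rw [Finset.card_eq_zero, Finset.filter_eq_empty_iff]
    exact fun a _ h => hb (hy a b h)
  · refine (isSpread_greedyStarts ℓ _).card_filter_le 1 (x₀ := x₀) (ρ := ℓ) (fun a _ h => ?_)
      (by norm_num)
    -- The half-chord is at most `ℓ` because `(61 / 50) ^ 2 - 1 < 1`.
    have h1 : ℓ ^ 2 ≤ (b - y₀) ^ 2 := by
      rw [← sq_abs (b - y₀)]
      exact pow_le_pow_left₀ hℓ.le (not_le.mp hb).le 2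
    have h2 : R ^ 2 ≤ (61 / 50 * ℓ) ^ 2 := pow_le_pow_left₀ hR0 hR 2
    exact abs_le_of_sq_le_sq (by nlinarith [sq_nonneg ℓ]) hℓ.le
  · exact (isSpread_greedyStarts ℓ _).card_filter_le 2 (fun a _ h => hx a b h)
      (by norm_num; linarith)
  · exact (isSpread_greedyStarts ℓ _).card_filter_le 2 (fun b _ h => h) (by norm_num; linarith)
  · exact (isSpread_greedyStarts ℓ _).card_filter_le 1 (fun b _ h => h) (by norm_num)

/-! ### From corners of squares to circles with faulty leaders -/

theorem mem_closedBall_plane {c x : Plane} {R : ℝ} (hR : 0 ≤ R) :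
    x ∈ Metric.closedBall c R ↔ (x 0 - c 0) ^ 2 + (x 1 - c 1) ^ 2 ≤ R ^ 2 := by
  rw [Metric.mem_closedBall, EuclideanSpace.dist_eq, Real.sqrt_le_left hR, Fin.sum_univ_two,
    Real.dist_eq, Real.dist_eq, sq_abs, sq_abs]

open Classical in
theorem card_circleCover_filter_le {N : ℕ} (pos : Fin N → Plane) {ℓ R : ℝ} (hR : 0 ≤ R) {k : ℕ}
    (hk : ∀ x₀ y₀ : ℝ, ((squareCover pos ℓ).filter
      fun ab => (ab.1 - x₀) ^ 2 + (ab.2 - y₀) ^ 2 ≤ R ^ 2).card ≤ k) (z : Plane) :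
    ((circleCover pos ℓ).filter (fun c => c ∈ Metric.closedBall z R)).card ≤ 4 * k := by
  -- For a fixed offset `o`, the disc is translated back by `o`, so that corners are counted instead
  -- of centers.
  let F : ℝ × ℝ → Finset Plane := fun o => ((squareCover pos ℓ).filter
    fun ab => (ab.1 - (z 0 - o.1)) ^ 2 + (ab.2 - (z 1 - o.2)) ^ 2 ≤ R ^ 2).image
      fun ab => !₂[ab.1 + o.1, ab.2 + o.2]
  have hF : ∀ o, (F o).card ≤ k := fun o => Finset.card_image_le.trans (hk _ _)
  have hmem : ∀ o : ℝ × ℝ, ∀ ab ∈ squareCover pos ℓ,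
      (!₂[ab.1 + o.1, ab.2 + o.2] : Plane) ∈ Metric.closedBall z R →
      (!₂[ab.1 + o.1, ab.2 + o.2] : Plane) ∈ F o := by
    intro o ab hab h
    rw [mem_closedBall_plane hR] at h
    refine Finset.mem_image.mpr ⟨ab, Finset.mem_filter.mpr ⟨hab, ?_⟩, rfl⟩
    simp only [Matrix.cons_val_zero, Matrix.cons_val_one] at h
    convert h using 3 <;> ring
  have hsub : (circleCover pos ℓ).filter (fun c => c ∈ Metric.closedBall z R) ⊆
      F (ℓ / 2, 0) ∪ (F (ℓ / 2, ℓ) ∪ (F (0, ℓ / 2) ∪ F (ℓ, ℓ / 2))) := by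
    intro c hc
    obtain ⟨hc, hcz⟩ := Finset.mem_filter.mp hc
    rw [circleCover] at hc
    obtain ⟨ab, hab, hc⟩ := Finset.mem_biUnion.mp (Finset.mem_filter.mp hc).1
    have h1 := hmem (ℓ / 2, 0) ab hab
    have h2 := hmem (ℓ / 2, ℓ) ab hab
    have h3 := hmem (0, ℓ / 2) ab hab
    have h4 := hmem (ℓ, ℓ / 2) ab hab
    simp only [add_zero] at h1 h2 h3 h4
    simp only [Finset.mem_insert, Finset.mem_singleton] at hc
    simp only [Finset.mem_union]
    rcases hc with rfl | rfl | rfl | rfl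
    · exact Or.inl (h1 hcz)
    · exact Or.inr (Or.inl (h2 hcz))
    · exact Or.inr (Or.inr (Or.inl (h3 hcz)))
    · exact Or.inr (Or.inr (Or.inr (h4 hcz)))
  have h0 := Finset.card_le_card hsub
  have h1 := Finset.card_union_le (F (ℓ / 2, 0)) (F (ℓ / 2, ℓ) ∪ (F (0, ℓ / 2) ∪ F (ℓ, ℓ / 2)))
  have h2 := Finset.card_union_le (F (ℓ / 2, ℓ)) (F (0, ℓ / 2) ∪ F (ℓ, ℓ / 2))
  have h3 := Finset.card_union_le (F (0, ℓ / 2)) (F (ℓ, ℓ / 2))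
  have e1 := hF (ℓ / 2, 0)
  have e2 := hF (ℓ / 2, ℓ)
  have e3 := hF (0, ℓ / 2)
  have e4 := hF (ℓ, ℓ / 2)
  omega

open Classical in
theorem leader_mem_closedBall {N : ℕ} {pos : Fin N → Plane} {ℓ : ℝ} (c : Cover pos ℓ) :
    pos (leader c) ∈ Metric.closedBall c.1 (ℓ / 2) := by
  have h := (Classical.choose_spec (Finset.exists_min_image (coveredBy pos ℓ c.1)
    (fun p => toLex (pos p 1, pos p 0)) c.nonempty)).1
  exact (Finset.mem_filter.mp h).2

/-- The circles of the cover with a faulty leader. -/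
noncomputable def faultyCircles {N : ℕ} (pos : Fin N → Plane) (ℓ : ℝ) (faulty : Finset (Fin N)) :
    Finset (Cover pos ℓ) :=
  Finset.univ.filter fun c => leader c ∈ faulty

open Classical in
-- A faulty leader lies both in its circle and in a fault disc, so the triangle inequality bounds
-- the distance of the centers. Circles are counted, not leaders, because a process plays one role
-- per circle.
theorem card_faultyCircles_le {N M : ℕ} {pos : Fin N → Plane} {ℓ D : ℝ}
    {faulty : Finset (Fin N)} (hfault : IsFaultPattern pos M D faulty) {n : ℕ}
    (hn : ∀ z : Plane,
      ((circleCover pos ℓ).filter (fun c => c ∈ Metric.closedBall z ((ℓ + D) / 2))).card ≤ n) :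
    (faultyCircles pos ℓ faulty).card ≤ n * M := by
  obtain ⟨center, hcenter⟩ := hfault
  have hsub : (faultyCircles pos ℓ faulty).map (Function.Embedding.subtype _) ⊆
      Finset.univ.biUnion fun i : Fin M => (circleCover pos ℓ).filter
        (fun c => c ∈ Metric.closedBall (center i) ((ℓ + D) / 2)) := by
    intro x hx
    obtain ⟨c, hc, rfl⟩ := Finset.mem_map.mp hx
    obtain ⟨i, hi⟩ := hcenter _ (Finset.mem_filter.mp hc).2
    refine Finset.mem_biUnion.mpr ⟨i, Finset.mem_univ i, Finset.mem_filter.mpr ⟨c.2, ?_⟩⟩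
    have hl := Metric.mem_closedBall'.mp (leader_mem_closedBall c)
    have htri := dist_triangle c.1 (pos (leader c)) (center i)
    rw [Metric.mem_closedBall] at hi ⊢
    simp only [Function.Embedding.subtype_apply]
    linarith
  have h1 := Finset.card_le_card hsub
  rw [Finset.card_map] at h1
  have h2 := Finset.card_biUnion_le_card_mul Finset.univ
    (fun i : Fin M => (circleCover pos ℓ).filter
        (fun c => c ∈ Metric.closedBall (center i) ((ℓ + D) / 2))) n (fun i _ => hn (center i))
  rw [Finset.card_univ, Fintype.card_fin, mul_comm] at h2
  exact h1.trans h2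

/-! ### Computations of GENERIC -/

section Generic

variable {N : ℕ} {pos : Fin N → Plane} {ℓ : ℝ} {t : ℕ} {faulty : Finset (Fin N)}
  {input : Fin N → Bool} {state : ℕ → Fin N → GenericState (Cover pos ℓ)}
  {msg : ℕ → Fin N → Fin N → Option (GenericMsg (Cover pos ℓ))}

theorem mem_faultyCircles {c : Cover pos ℓ} : c ∈ faultyCircles pos ℓ faulty ↔ leader c ∈ faulty := by
  simp [faultyCircles]

theorem generic_view_zero (h : (generic pos ℓ t).IsComputation faulty input state msg)
    {p : Fin N} (hp : p ∉ faulty) : (state 0 p).view [] = input p := by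
  rw [h.start p hp]
  simp [generic]

theorem generic_view_nil (h : (generic pos ℓ t).IsComputation faulty input state msg)
    {p : Fin N} (hp : p ∉ faulty) (r : ℕ) : (state r p).view [] = input p := by
  induction r with
  | zero => exact generic_view_zero h hp
  | succ r ih =>
    rw [h.steps r p hp, ← ih]
    simp only [generic]
    split_ifs <;> rfl

/-- Round `r` writes only words of length `r + 1`. -/
theorem generic_view_succ (h : (generic pos ℓ t).IsComputation faulty input state msg)
    {p : Fin N} (hp : p ∉ faulty) {r : ℕ} {w : List (Cover pos ℓ)} (hw : w.length ≤ r) :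
    (state (r + 1) p).view w = (state r p).view w := by
  rw [h.steps r p hp]
  cases w with
  | nil => simp only [generic]; split_ifs <;> rfl
  | cons c w =>
    have : w.length ≠ r := by simp at hw; omega
    simp only [generic]
    split_ifs <;> simp only [this, if_false]

theorem generic_view_stable (h : (generic pos ℓ t).IsComputation faulty input state msg)
    {p : Fin N} (hp : p ∉ faulty) {r r' : ℕ} (hr : r ≤ r') {w : List (Cover pos ℓ)}
    (hw : w.length ≤ r) : (state r' p).view w = (state r p).view w := by
  induction r', hr using Nat.le_induction with
  | base => rfl
  | succ n hn ih => rw [generic_view_succ h hp (hw.trans hn), ih]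

theorem generic_view_cons (h : (generic pos ℓ t).IsComputation faulty input state msg)
    {c d : Cover pos ℓ} (hc : leader c ∉ faulty) (hd : leader d ∉ faulty)
    {w : List (Cover pos ℓ)} (hw : w.length ≤ t) :
    (state (w.length + 1) (leader c)).view (d :: w) = (state w.length (leader d)).view w := by
  have hLc : ∃ c' : Cover pos ℓ, leader c' = leader c := ⟨c, rfl⟩
  have hLd : ∃ c' : Cover pos ℓ, leader c' = leader d := ⟨d, rfl⟩
  rw [h.steps _ _ hc]
  simp only [generic, if_pos hLc, if_pos hw, if_true]
  rw [h.sends _ _ hd]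
  simp only [generic, if_pos hLc, if_pos hLd, if_pos hw, GenericMsg.value, if_true]

/-- The word `w` is relayed in round `w.length`, when its entry is already final; the last relay
round `t` allows exactly `w.length ≤ t`. -/
theorem generic_faithfulReports (h : (generic pos ℓ t).IsComputation faulty input state msg) :
    FaithfulReports (faultyCircles pos ℓ faulty) t
      (fun c => (state (t + 1) (leader c)).view) := by
  intro c hc d hd w hw
  rw [mem_faultyCircles] at hc hd
  change (state (t + 1) (leader c)).view (d :: w) = (state (t + 1) (leader d)).view w
  rw [generic_view_stable h hc (r := w.length + 1) (by omega) (by simp),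
    generic_view_cons h hc hd hw, generic_view_stable h hd (r := w.length) (r' := t + 1) (by omega) le_rfl]

/-! ### Decisions and the announcement round -/

theorem generic_decided_early (h : (generic pos ℓ t).IsComputation faulty input state msg)
    {p : Fin N} (hp : p ∉ faulty) {r : ℕ} (hr : r ≤ t) : (state r p).decided = none := by
  induction r with
  | zero => rw [h.start p hp]; rfl
  | succ r ih =>
    have ih := ih (by omega)
    rw [h.steps r p hp]
    simp only [generic]
    split_ifs <;> omega

theorem generic_leader_decided_first (h : (generic pos ℓ t).IsComputation faulty input state msg)
    {c : Cover pos ℓ} (hc : leader c ∉ faulty) :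
    (state (t + 1) (leader c)).decided =
      some (pslDecision t (state (t + 1) (leader c)).view) := by
  have hLc : ∃ c' : Cover pos ℓ, leader c' = leader c := ⟨c, rfl⟩
  rw [h.steps t _ hc]
  simp only [generic, if_pos hLc, le_refl, if_true]

theorem generic_leader_decided (h : (generic pos ℓ t).IsComputation faulty input state msg)
    {c : Cover pos ℓ} (hc : leader c ∉ faulty) {r : ℕ} (hr : t + 1 ≤ r) :
    (state r (leader c)).decided = some (pslDecision t (state (t + 1) (leader c)).view) := by
  have hLc : ∃ c' : Cover pos ℓ, leader c' = leader c := ⟨c, rfl⟩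
  induction r, hr using Nat.le_induction with
  | base => exact generic_leader_decided_first h hc
  | succ r hr ih =>
    have hrt : ¬ r ≤ t := by omega
    rw [h.steps r _ hc]
    simp only [generic, if_pos hLc, if_neg hrt]
    exact ih

theorem generic_announces (h : (generic pos ℓ t).IsComputation faulty input state msg)
    {c : Cover pos ℓ} (hc : leader c ∉ faulty) (q : Fin N) :
    msg (t + 1) (leader c) q =
      some (GenericMsg.announce (pslDecision t (state (t + 1) (leader c)).view)) := by
  have hLc : ∃ c' : Cover pos ℓ, leader c' = leader c := ⟨c, rfl⟩
  have ht : ¬ t + 1 ≤ t := by omega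
  rw [h.sends _ _ hc]
  simp only [generic, if_pos hLc, if_neg ht, if_true, generic_leader_decided h hc le_rfl,
    Option.map_some]

/-- If all correct leaders announce `v`, then every announced decision that is adopted is `v`. -/
theorem adopted_eq (hcard : 3 * t < (circleCover pos ℓ).card)
    (hbad : (faultyCircles pos ℓ faulty).card ≤ t)
    {inbox : Fin N → Option (GenericMsg (Cover pos ℓ))} {v : Bool}
    (hv : ∀ c : Cover pos ℓ, leader c ∉ faulty → inbox (leader c) = some (GenericMsg.announce v)) :
    (if 2 * t + 1 ≤ announcements pos ℓ inbox true then some true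
      else if 2 * t + 1 ≤ announcements pos ℓ inbox false then some false else none) = some v := by
  classical
  have hyes : (faultyCircles pos ℓ faulty)ᶜ.card ≤ announcements pos ℓ inbox v := by
    refine Finset.card_le_card fun c hc => Finset.mem_filter.mpr ⟨Finset.mem_univ c, hv c ?_⟩
    rwa [Finset.mem_compl, mem_faultyCircles] at hc
  have hno : announcements pos ℓ inbox (!v) ≤ (faultyCircles pos ℓ faulty).card := by
    refine Finset.card_le_card fun c hc => ?_
    rw [mem_faultyCircles]
    by_contra hcf
    have := (Finset.mem_filter.mp hc).2
    rw [hv c hcf] at this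
    simp at this
  have hc : Fintype.card (Cover pos ℓ) = (circleCover pos ℓ).card := Fintype.card_coe _
  rw [Finset.card_compl, hc] at hyes
  -- At least `2 * t + 1` circles announce `v` and at most `t` announce its negation, so only `v`
  -- reaches the threshold.
  cases v with
  | true => rw [if_pos (by omega)]
  | false =>
    rw [Bool.not_false] at hno
    rw [if_neg (by omega), if_pos (by omega)]

theorem generic_nonleader_undecided (h : (generic pos ℓ t).IsComputation faulty input state msg)
    {p : Fin N} (hp : p ∉ faulty) (hL : ¬ ∃ c : Cover pos ℓ, leader c = p) :
    (state (t + 1) p).decided = none := by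
  have ht : t ≠ t + 1 := by omega
  rw [h.steps t p hp]
  simp only [generic, if_neg hL, if_neg ht]
  exact generic_decided_early h hp le_rfl

theorem generic_nonleader_decided (h : (generic pos ℓ t).IsComputation faulty input state msg)
    (hcard : 3 * t < (circleCover pos ℓ).card)
    (hbad : (faultyCircles pos ℓ faulty).card ≤ t) {v : Bool}
    (hv : ∀ c : Cover pos ℓ, leader c ∉ faulty →
      pslDecision t (state (t + 1) (leader c)).view = v)
    {p : Fin N} (hp : p ∉ faulty) (hL : ¬ ∃ c : Cover pos ℓ, leader c = p)
    {r : ℕ} (hr : t + 2 ≤ r) : (state r p).decided = some v := by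
  induction r, hr using Nat.le_induction with
  | base =>
    rw [show t + 2 = (t + 1) + 1 from rfl, h.steps (t + 1) p hp]
    simp only [generic, if_neg hL, if_true]
    exact adopted_eq hcard hbad fun c hc => by rw [generic_announces h hc p, hv c hc]
  | succ r hr ih =>
    have hrt : r ≠ t + 1 := by omega
    rw [h.steps r p hp]
    simp only [generic, if_neg hL, if_neg hrt]
    exact ih

/-- GENERIC solves consensus when at most `t` of more than `3 t` circles have a faulty leader. -/
theorem generic_solvesConsensus (hcard : 3 * t < (circleCover pos ℓ).card)
    (hbad : (faultyCircles pos ℓ faulty).card ≤ t) :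
    (generic pos ℓ t).SolvesConsensus faulty (t + 2) := by
  classical
  intro input state msg h
  have hc : Fintype.card (Cover pos ℓ) = (circleCover pos ℓ).card := Fintype.card_coe _
  have hcard' : 3 * t < Fintype.card (Cover pos ℓ) := by rwa [hc]
  have hfaith := generic_faithfulReports h
  obtain ⟨c₀, hc₀⟩ : ∃ c : Cover pos ℓ, c ∉ faultyCircles pos ℓ faulty := by
    by_contra! hall
    have := Finset.card_le_card (fun c _ => hall c :
      (Finset.univ : Finset (Cover pos ℓ)) ⊆ faultyCircles pos ℓ faulty)
    rw [Finset.card_univ] at this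
    omega
  -- The decision at one correct circle serves as the common value.
  obtain ⟨u, hu⟩ : ∃ u, pslDecision t (state (t + 1) (leader c₀)).view = u := ⟨_, rfl⟩
  have hv : ∀ c : Cover pos ℓ, leader c ∉ faulty →
      pslDecision t (state (t + 1) (leader c)).view = u := fun c hcf =>
    (pslDecision_agreement hfaith hcard' hbad (mt mem_faultyCircles.mp hcf) hc₀).trans hu
  have hlate : ∀ p, p ∉ faulty → ∀ r, t + 2 ≤ r → (state r p).decided = some u := by
    intro p hp r hr
    by_cases hL : ∃ c : Cover pos ℓ, leader c = p
    · obtain ⟨c, rfl⟩ := hL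
      rw [generic_leader_decided h hp (by omega), hv c hp]
    · exact generic_nonleader_decided h hcard hbad hv hp hL hr
  have hmid : ∀ p, p ∉ faulty →
      (state (t + 1) p).decided = some u ∨ (state (t + 1) p).decided = none := by
    intro p hp
    by_cases hL : ∃ c : Cover pos ℓ, leader c = p
    · obtain ⟨c, rfl⟩ := hL
      exact Or.inl (by rw [generic_leader_decided h hp le_rfl, hv c hp])
    · exact Or.inr (generic_nonleader_undecided h hp hL)
  -- Any recorded decision is `u` and persists, which yields irrevocability and agreement together.
  have hmono : ∀ p, p ∉ faulty → ∀ r r' v, r ≤ r' → (state r p).decided = some v →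
      v = u ∧ (state r' p).decided = some u := by
    intro p hp r r' v hr hdec
    rcases Nat.lt_or_ge t r with hrt | hrt
    swap
    · rw [generic_decided_early h hp hrt] at hdec
      simp at hdec
    rcases Nat.lt_or_ge (t + 1) r with hrt' | hrt'
    · rw [hlate p hp r hrt'] at hdec
      exact ⟨(Option.some.inj hdec).symm, hlate p hp r' (by omega)⟩
    · obtain rfl : r = t + 1 := by omega
      rcases hmid p hp with hd | hd
      · refine ⟨Option.some.inj (hdec.symm.trans hd), ?_⟩
        rcases Nat.eq_or_lt_of_le hr with rfl | hlt
        · exact hd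
        · exact hlate p hp r' hlt
      · rw [hd] at hdec
        simp at hdec
  refine ⟨fun p hp r r' v hr hdec => ?_, fun p hp q hq r r' v v' h1 h2 => ?_, fun v hin p hp => ?_,
    fun p hp => ⟨t + 2, u, le_rfl, hlate p hp _ le_rfl⟩⟩
  · obtain ⟨rfl, hd⟩ := hmono p hp r r' v hr hdec
    exact hd
  · rw [(hmono p hp r r v le_rfl h1).1, (hmono q hq r' r' v' le_rfl h2).1]
  · refine ⟨t + 2, (hlate p hp _ le_rfl).trans (congrArg some ?_)⟩
    rw [← hu]
    refine pslDecision_validity hfaith hcard' hbad (fun q hq => ?_) hc₀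
    have hq' : leader q ∉ faulty := mt mem_faultyCircles.mpr hq
    exact (generic_view_nil h hq' _).trans (hin _ hq')

end Generic

/-! ### The three sizes of fault areas -/

theorem mainTheorem5 (N M : ℕ) (hM : 1 ≤ M) (pos : Fin N → Plane)
    (hpos : Function.Injective pos) (ℓ : ℝ) (hℓ : 0 < ℓ) :
    (85 * M ≤ (circleCover pos ℓ).card →
      ∀ faulty : Finset (Fin N), IsFaultPattern pos M ℓ faulty → faulty.card + 57 * M ≤ N →
        (generic pos ℓ (28 * M)).SolvesConsensus faulty (28 * M + 2)) ∧
    (97 * M ≤ (circleCover pos ℓ).card →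
      ∀ faulty : Finset (Fin N), IsFaultPattern pos M (√2 * ℓ) faulty →
        faulty.card + 65 * M ≤ N →
        (generic pos ℓ (32 * M)).SolvesConsensus faulty (32 * M + 2)) ∧
    (49 * M ≤ (circleCover pos ℓ).card →
      ∀ faulty : Finset (Fin N), IsFaultPattern pos M (ℓ / √2) faulty →
        faulty.card + 33 * M ≤ N →
        (generic pos ℓ (16 * M)).SolvesConsensus faulty (16 * M + 2)) := by
  refine ⟨fun hA faulty hf _ => ?_, fun hA faulty hf _ => ?_, fun hA faulty hf _ => ?_⟩
  -- Here `85 = 3 * 28 + 1`, so `1 ≤ M` gives the strict bound `3 * t < |𝒜|`; likewise `97` and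
  -- `49`. The disc has radius `ℓ`, and the count is in fact at most 16.
  · refine generic_solvesConsensus (by omega) (card_faultyCircles_le hf fun z => ?_)
    exact (card_circleCover_filter_le pos (by positivity)
      (card_squareCover_filter_le_four pos (by positivity) (by linarith)) z).trans (by norm_num)
  · refine generic_solvesConsensus (by omega) (card_faultyCircles_le hf fun z => ?_)
    -- This yields the radius bound `(1 + 36 / 25) / 2 = 61 / 50` of the eight-corner lemma.
    have h2 : √2 ≤ 36 / 25 := Real.sqrt_le_iff.mpr (by norm_num)
    exact card_circleCover_filter_le pos (by positivity)
      (card_squareCover_filter_le_eight pos hℓ (by positivity) (by nlinarith)) z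
  · refine generic_solvesConsensus (by omega) (card_faultyCircles_le hf fun z => ?_)
    have h2 : ℓ / √2 ≤ ℓ := div_le_self hℓ.le (Real.one_le_sqrt.mpr (by norm_num))
    exact card_circleCover_filter_le pos (by positivity)
      (card_squareCover_filter_le_four pos (by positivity) (by linarith)) z
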